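/- Let $S^2\subset\mathbb{R}^3$ be the unit sphere with its outward orientation, $a:S^2\to S^2$, $a(x)=-x$, the antipodal map, and $\omega$ the standard volume form, $\omega_x(u,v)=x\cdot(u\times v)$, of total integral $4\pi$. For a smooth map $\phi:S^2\to S^2$ put $\mathrm{Vol}_{\phi}=\phi^*\omega$, so that $(\mathrm{Vol}_\phi)_x(u,v)=\phi(x)\cdot(D\phi_x u\times D\phi_x v)$, and let the degree of $\phi$ be $\deg\phi=\int_{S^2}\phi^*\big(\tfrac{1}{4\pi}\omega\big)$. A two-form $\alpha$ on $S^2$ is called odd if $a^*\alpha=-\alpha$. For every nonzero integer $m$ there is a smooth map $\phi_\infty:S^2\to S^2$ of degree $m$ such that $\mathrm{Vol}_{\phi_\infty}$ is odd. -/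

import Mathlib

open scoped Manifold ContDiff Matrix

noncomputable section

namespace HiggsVacuum

/-- Euclidean three-space. -/
abbrev E3 : Type := EuclideanSpace ℝ (Fin 3)

/-- The unit sphere in `E3`, with the manifold structure that Mathlib gives it. -/
abbrev S2 : Type := Metric.sphere (0 : E3) 1

section Forms

variable {E : Type*} [NormedAddCommGroup E] [NormedSpace ℝ E]
  {H : Type*} [TopologicalSpace H] (I : ModelWithCorners ℝ E H)
  (M : Type*) [TopologicalSpace M] [ChartedSpace H M]
  {E' : Type*} [NormedAddCommGroup E'] [NormedSpace ℝ E']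
  {H' : Type*} [TopologicalSpace H'] (I' : ModelWithCorners ℝ E' H')
  {N : Type*} [TopologicalSpace N] [ChartedSpace H' N]

/-- Two-forms on `M`: an alternating bilinear form on every tangent space. -/
abbrev TwoForm : Type _ := (x : M) → (TangentSpace I x) [⋀^Fin 2]→ₗ[ℝ] ℝ

variable {M}

/-- The pullback `(f^*α)_x(u, v) = α_{f(x)}(Df_x u, Df_x v)`. -/
def pullback (f : M → N) (α : TwoForm I' N) : TwoForm I M :=
  fun x => (α (f x)).compLinearMap (mfderiv I I' f x).toLinearMap

end Forms

/-- The differential at `x` of the inclusion of the sphere into three-space. -/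
def inclDeriv (x : S2) : TangentSpace (𝓡 2) x →L[ℝ] E3 :=
  mfderiv (𝓡 2) 𝓘(ℝ, E3) (Subtype.val : S2 → E3) x

/-- The trilinear alternating form `(u, v, w) ↦ det (u, v, w)` on three-space. -/
def detForm : E3 [⋀^Fin 3]→ₗ[ℝ] ℝ :=
  (Matrix.detRowAlternating (n := Fin 3) (R := ℝ)).compLinearMap
    (WithLp.linearEquiv 2 ℝ (Fin 3 → ℝ)).toLinearMap

/-- The standard volume form `ω` of the sphere for the outward orientation:
`ω_x(u, v) = det (x, u, v) = x · (u × v)`; its total integral is `4π`. -/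
def areaForm : TwoForm (𝓡 2) S2 :=
  fun x => (detForm.curryLeft (x : E3)).compLinearMap (inclDeriv x).toLinearMap

theorem areaForm_apply (x : S2) (u v : TangentSpace (𝓡 2) x) :
    areaForm x ![u, v] =
      (x : E3).ofLp ⬝ᵥ ((inclDeriv x u).ofLp ⨯₃ (inclDeriv x v).ofLp) := by
  rw [triple_product_eq_det]
  simp only [areaForm, detForm, AlternatingMap.compLinearMap_apply,
    AlternatingMap.curryLeft_apply_apply]
  change Matrix.det _ = _
  congr 1
  ext i j
  fin_cases i <;> rfl

/-- The antipodal map. -/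
def antipode : S2 → S2 := fun x => -x

/-- A two-form on the sphere is odd under parity if its pullback by the antipodal map
is its negative. -/
def IsOddForm (α : TwoForm (𝓡 2) S2) : Prop :=
  pullback (𝓡 2) (𝓡 2) antipode α = -α

/-- Spherical coordinates
`(θ, φ) ↦ (sin θ cos φ, sin θ sin φ, cos θ)`. -/
def spherical (p : ℝ × ℝ) : S2 :=
  ⟨!₂[Real.sin p.1 * Real.cos p.2, Real.sin p.1 * Real.sin p.2, Real.cos p.1], by
    rw [mem_sphere_zero_iff_norm, EuclideanSpace.norm_eq, Real.sqrt_eq_one]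
    simp only [Real.norm_eq_abs, sq_abs, Fin.sum_univ_three]
    simp only [Matrix.cons_val_zero, Matrix.cons_val_one, Matrix.cons_val]
    nlinarith [Real.sin_sq_add_cos_sq p.1, Real.sin_sq_add_cos_sq p.2]⟩

/-- The integral of a two-form over the outward oriented sphere. On
`(0, π) × (0, 2π)` spherical coordinates are an orientation preserving diffeomorphism
onto the complement of a half great circle, so the integral is that of
`α (∂/∂θ, ∂/∂φ)` over this rectangle. -/
def integralS2 (α : TwoForm (𝓡 2) S2) : ℝ :=
  ∫ p in Set.Ioo (0 : ℝ) Real.pi ×ˢ Set.Ioo (0 : ℝ) (2 * Real.pi),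
    pullback 𝓘(ℝ, ℝ × ℝ) (𝓡 2) spherical α p ![((1, 0) : ℝ × ℝ), ((0, 1) : ℝ × ℝ)]

/-- The two-form `Vol_f = f^*ω` of a map `f` of the sphere to itself. -/
def volForm (f : S2 → S2) : TwoForm (𝓡 2) S2 :=
  pullback (𝓡 2) (𝓡 2) f areaForm

/-- The degree (winding number, magnetic charge) of a smooth map of the sphere to itself:
the integral of the pullback of the normalized volume form `ω / 4π`. -/
def degree (f : C^∞⟮𝓡 2, S2; 𝓡 2, S2⟯) : ℝ :=
  integralS2 (pullback (𝓡 2) (𝓡 2) f ((4 * Real.pi)⁻¹ • areaForm))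

/-- The sector of charge `m` in the space of Higgs vacua: the smooth maps of the sphere to
itself that have degree `m`. -/
def vacuumSector (m : ℤ) : Set C^∞⟮𝓡 2, S2; 𝓡 2, S2⟯ :=
  {f | degree f = m}

end HiggsVacuum

end

noncomputable section

namespace HiggsVacuum

open scoped EuclideanSpace

section Pullback

variable {E : Type*} [NormedAddCommGroup E] [NormedSpace ℝ E]
  {H : Type*} [TopologicalSpace H] {I : ModelWithCorners ℝ E H}
  {M : Type*} [TopologicalSpace M] [ChartedSpace H M]
  {E' : Type*} [NormedAddCommGroup E'] [NormedSpace ℝ E']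
  {H' : Type*} [TopologicalSpace H'] {I' : ModelWithCorners ℝ E' H'}
  {N : Type*} [TopologicalSpace N] [ChartedSpace H' N]
  {E'' : Type*} [NormedAddCommGroup E''] [NormedSpace ℝ E'']
  {H'' : Type*} [TopologicalSpace H''] {I'' : ModelWithCorners ℝ E'' H''}
  {P : Type*} [TopologicalSpace P] [ChartedSpace H'' P]

/-! Write a point of the sphere as `(z, x₂)` with `z` complex. Take the direction of `(z ^ k, x₂)`
with `k = |m|`, conjugating `z` when `m < 0`. The antipodal map turns this vector into its image
under `diag (e, e, -1)`, `e = (-1) ^ k`, an isometry of determinant `-1`; hence the pulled-back area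
form is odd (`isOddForm_volForm_of_mirror`). In spherical coordinates the map multiplies longitude
by `m`, and the area density is `-m` times the derivative of the height `C`, so the degree depends
only on `C` at the poles (`degree_of_spherical`). -/

theorem pullback_pullback {g : N → P} {f : M → N} (α : TwoForm I'' P) {x : M}
    (hg : MDifferentiableAt I' I'' g (f x)) (hf : MDifferentiableAt I I' f x) :
    pullback I I' f (pullback I' I'' g α) x = pullback I I'' (g ∘ f) α x := by
  unfold pullback
  rw [mfderiv_comp x hg hf]
  rfl

/-- Reduces pullbacks of the area form to vector calculus for maps into three-space. -/
theorem pullback_areaForm_apply {f : M → S2} {x : M}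
    (hf : MDifferentiableAt I (𝓡 2) f x) (u v : TangentSpace I x) :
    pullback I (𝓡 2) f areaForm x ![u, v] =
      (f x : E3).ofLp ⬝ᵥ
        (((mfderiv I 𝓘(ℝ, E3) (Subtype.val ∘ f) x u : E3).ofLp) ⨯₃
          ((mfderiv I 𝓘(ℝ, E3) (Subtype.val ∘ f) x v : E3).ofLp)) := by
  have hv : MDifferentiableAt (𝓡 2) 𝓘(ℝ, E3) (Subtype.val : S2 → E3) (f x) :=
    (contMDiff_coe_sphere (m := 1)).mdifferentiable one_ne_zero _
  rw [mfderiv_comp x hv hf]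
  have h := areaForm_apply (f x) (mfderiv I (𝓡 2) f x u) (mfderiv I (𝓡 2) f x v)
  have e : pullback I (𝓡 2) f areaForm x ![u, v] =
      areaForm (f x) ![mfderiv I (𝓡 2) f x u, mfderiv I (𝓡 2) f x v] := by
    simp only [pullback, AlternatingMap.compLinearMap_apply]
    congr 1
    ext i
    fin_cases i <;> rfl
  rw [e, h]
  rfl

end Pullback

theorem twoForm_ext {E : Type*} [AddCommGroup E] [Module ℝ E] {α β : E [⋀^Fin 2]→ₗ[ℝ] ℝ}
    (h : ∀ u v, α ![u, v] = β ![u, v]) : α = β := by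
  ext w
  have : w = ![w 0, w 1] := by ext i; fin_cases i <;> rfl
  rw [this]
  exact h _ _

/-! ### Parity from an orientation-reversing symmetry -/

/-- The linear map `diag (e, e, -1)` of three-space. -/
def mirror (e : ℝ) : E3 →L[ℝ] E3 :=
  LinearMap.toContinuousLinearMap
    { toFun := fun x => !₂[e * x 0, e * x 1, -x 2]
      map_add' := fun x y => by
        ext i; fin_cases i <;> simp <;> ring
      map_smul' := fun c x => by
        ext i; fin_cases i <;> simp <;> ring }

theorem mirror_apply (e : ℝ) (x : E3) : mirror e x = !₂[e * x 0, e * x 1, -x 2] := rfl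

/-- The determinant of `mirror e` is `-e ^ 2 = -1`. -/
theorem triple_product_mirror {e : ℝ} (he : e ^ 2 = 1) (u v w : E3) :
    (mirror e u).ofLp ⬝ᵥ ((mirror e v).ofLp ⨯₃ (mirror e w).ofLp) =
      -(u.ofLp ⬝ᵥ (v.ofLp ⨯₃ w.ofLp)) := by
  simp only [mirror_apply, cross_apply, dotProduct, Fin.sum_univ_three, Matrix.cons_val_zero,
    Matrix.cons_val_one, Matrix.cons_val]
  linear_combination (-(u 0 * (v 1 * w 2 - v 2 * w 1) + u 1 * (v 2 * w 0 - v 0 * w 2) +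
    u 2 * (v 0 * w 1 - v 1 * w 0))) * he

theorem norm_mirror {e : ℝ} (he : e ^ 2 = 1) (x : E3) : ‖mirror e x‖ = ‖x‖ := by
  simp only [EuclideanSpace.norm_eq, mirror_apply, Fin.sum_univ_three, Real.norm_eq_abs, sq_abs,
    Matrix.cons_val_zero, Matrix.cons_val_one, Matrix.cons_val]
  congr 1
  linear_combination (x 0 ^ 2 + x 1 ^ 2) * he

/-- A map that intertwines the antipodal map with `diag (e, e, -1)`, `e = ±1`, pulls the volume
form back to an odd form. -/
theorem isOddForm_volForm_of_mirror {f : S2 → S2} (hf : MDifferentiable (𝓡 2) (𝓡 2) f)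
    {e : ℝ} (he : e ^ 2 = 1) (h : ∀ x : S2, (f (-x) : E3) = mirror e (f x)) :
    IsOddForm (volForm f) := by
  have ha : MDifferentiable (𝓡 2) (𝓡 2) antipode :=
    (contMDiff_neg_sphere (m := 1) (E := E3)).mdifferentiable one_ne_zero
  funext x
  refine twoForm_ext fun u v => ?_
  rw [volForm, pullback_pullback _ (hf _) (ha _)]
  change _ = -(pullback (𝓡 2) (𝓡 2) f areaForm x ![u, v])
  rw [pullback_areaForm_apply ((hf _).comp x (ha x)), pullback_areaForm_apply (hf x)]
  have hv : MDifferentiable (𝓡 2) 𝓘(ℝ, E3) (Subtype.val : S2 → E3) :=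
    (contMDiff_coe_sphere (m := 1)).mdifferentiable one_ne_zero
  have e1 : (Subtype.val ∘ f ∘ antipode : S2 → E3) = mirror e ∘ (Subtype.val ∘ f) :=
    funext h
  have e2 : ((f ∘ antipode) x : E3) = mirror e (f x) := h x
  rw [e1, e2, mfderiv_comp x ((mirror e).mdifferentiableAt) ((hv _).comp x (hf x)),
    ContinuousLinearMap.mfderiv_eq]
  exact triple_product_mirror he _ _ _

/-! ### Degree in spherical coordinates -/

theorem mdifferentiable_spherical : MDifferentiable 𝓘(ℝ, ℝ × ℝ) (𝓡 2) spherical := by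
  have h : ContMDiff 𝓘(ℝ, ℝ × ℝ) 𝓘(ℝ, E3) 1 (fun p => (spherical p : E3)) := by
    rw [contMDiff_iff_contDiff, contDiff_euclidean]
    intro i
    fin_cases i <;> simp [spherical] <;> fun_prop
  exact (h.codRestrict_sphere (n := 2) fun p => (spherical p).2).mdifferentiable one_ne_zero

/-- A map that in spherical coordinates multiplies the longitude by `m` and sends the latitude
circles to latitude circles, fixing the poles, has degree `m`. -/
theorem degree_of_spherical (f : C^∞⟮𝓡 2, S2; 𝓡 2, S2⟯) {S C : ℝ → ℝ}
    (hS : Differentiable ℝ S) (hC : ContDiff ℝ 1 C) (hSC : ∀ t, S t ^ 2 + C t ^ 2 = 1)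
    (h0 : C 0 = 1) (hpi : C Real.pi = -1) (m : ℝ)
    (hf : ∀ p, (f (spherical p) : E3) =
      !₂[S p.1 * Real.cos (m * p.2), S p.1 * Real.sin (m * p.2), C p.1]) :
    degree f = m := by
  have hfd : MDifferentiable (𝓡 2) (𝓡 2) f := f.contMDiff.mdifferentiable (by simp)
  have hCd : Differentiable ℝ C := hC.differentiable one_ne_zero
  have key : ∀ p : ℝ × ℝ, pullback 𝓘(ℝ, ℝ × ℝ) (𝓡 2) spherical
      (pullback (𝓡 2) (𝓡 2) f ((4 * Real.pi)⁻¹ • areaForm)) p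
        ![((1, 0) : ℝ × ℝ), ((0, 1) : ℝ × ℝ)] = deriv C p.1 * (-(m * (4 * Real.pi)⁻¹)) := by
    intro p
    rw [pullback_pullback _ (hfd _) (mdifferentiable_spherical _)]
    change (4 * Real.pi)⁻¹ * (pullback 𝓘(ℝ, ℝ × ℝ) (𝓡 2) (f ∘ spherical) areaForm p
      ![((1, 0) : ℝ × ℝ), ((0, 1) : ℝ × ℝ)]) = _
    have hp := pullback_areaForm_apply ((hfd _).comp p (mdifferentiable_spherical p))
      ((1, 0) : ℝ × ℝ) ((0, 1) : ℝ × ℝ)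
    refine (congrArg ((4 * Real.pi)⁻¹ * ·) hp).trans ?_
    beta_reduce
    rw [mfderiv_eq_fderiv]
    set F : ℝ × ℝ → E3 := fun p =>
      !₂[S p.1 * Real.cos (m * p.2), S p.1 * Real.sin (m * p.2), C p.1] with hF
    have e1 : (Subtype.val ∘ f ∘ spherical : ℝ × ℝ → E3) = F := funext hf
    have e2 : ((f ∘ spherical) p : E3) = F p := hf p
    rw [e1, e2]
    have hFd : DifferentiableAt ℝ F p := by
      rw [differentiableAt_euclidean]
      intro i
      fin_cases i <;> simp [hF] <;> fun_prop
    have hFi : ∀ i : Fin 3, HasFDerivAt (fun q => F q i)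
        ((EuclideanSpace.proj i : E3 →L[ℝ] ℝ).comp (fderiv ℝ F p)) p := fun i =>
      (EuclideanSpace.proj i : E3 →L[ℝ] ℝ).hasFDerivAt.comp p hFd.hasFDerivAt
    -- Restricting to coordinate lines lets uniqueness of one-variable derivatives identify the
    -- partials.
    have d1 : ∀ i : Fin 3, HasDerivAt (fun t => F (t, p.2) i)
        ((fderiv ℝ F p (1, 0)) i) p.1 := fun i =>
      HasFDerivAt.comp_hasDerivAt (f := fun t => (t, p.2)) p.1 (hFi i)
        ((hasDerivAt_id p.1).prodMk (hasDerivAt_const p.1 p.2))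
    have d2 : ∀ i : Fin 3, HasDerivAt (fun t => F (p.1, t) i)
        ((fderiv ℝ F p (0, 1)) i) p.2 := fun i =>
      HasFDerivAt.comp_hasDerivAt (f := fun t => (p.1, t)) p.2 (hFi i)
        ((hasDerivAt_const p.2 p.1).prodMk (hasDerivAt_id p.2))
    have hS' := (hS p.1).hasDerivAt
    have hC' := (hCd p.1).hasDerivAt
    have hm : HasDerivAt (fun t => m * t) m p.2 := by
      simpa using (hasDerivAt_id p.2).const_mul m
    have a0 := (d1 0).unique (hS'.mul_const (Real.cos (m * p.2)))
    have a1 := (d1 1).unique (hS'.mul_const (Real.sin (m * p.2)))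
    have a2 := (d1 2).unique hC'
    have b0 := (d2 0).unique (hm.cos.const_mul (S p.1))
    have b1 := (d2 1).unique (hm.sin.const_mul (S p.1))
    have b2 := (d2 2).unique (hasDerivAt_const p.2 (C p.1))
    have hSS : 2 * (S p.1 * deriv S p.1) + 2 * (C p.1 * deriv C p.1) = 0 := by
      have h1 := (hS'.pow 2).add (hC'.pow 2)
      have h2 : (S ^ 2 + C ^ 2 : ℝ → ℝ) = fun _ => 1 := funext hSC
      rw [h2] at h1
      have := h1.unique (hasDerivAt_const p.1 1)
      simp only [Nat.cast_ofNat] at this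
      linear_combination this
    rw [cross_apply]
    simp only [dotProduct, Fin.sum_univ_three, Matrix.cons_val_zero,
      Matrix.cons_val_one, Matrix.cons_val]
    erw [a0, a1, a2, b0, b1, b2]
    simp only [hF, Matrix.cons_val_zero, Matrix.cons_val_one, Matrix.cons_val]
    have hcs := Real.sin_sq_add_cos_sq (m * p.2)
    have hsc := hSC p.1
    set s := Real.sin (m * p.2)
    set c := Real.cos (m * p.2)
    -- The triple product is `m (C S S' - S² C')`; since `S S' = -C C'`, it equals `-m C' (S² + C²)
    -- = -m C'`.
    linear_combination (4 * Real.pi)⁻¹ * m * (-(S p.1 ^ 2 * deriv C p.1)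
      + C p.1 * S p.1 * deriv S p.1) * hcs + (4 * Real.pi)⁻¹ * m * C p.1 / 2 * hSS
      - (4 * Real.pi)⁻¹ * m * deriv C p.1 * hsc
  have hpos := Real.pi_pos
  have hint : ∫ t in Set.Ioo 0 Real.pi, deriv C t = -2 := by
    rw [← MeasureTheory.integral_Ioc_eq_integral_Ioo,
      ← intervalIntegral.integral_of_le hpos.le,
      intervalIntegral.integral_deriv_of_contDiffOn_Icc hC.contDiffOn hpos.le, h0, hpi]
    norm_num
  unfold degree integralS2
  simp_rw [key]
  rw [MeasureTheory.Measure.volume_eq_prod,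
    MeasureTheory.setIntegral_prod_mul (deriv C) (fun _ => -(m * (4 * Real.pi)⁻¹)), hint]
  simp [hpos.le]
  field_simp
  ring

/-! ### The winding maps -/

/-- The vector `(Re z ^ k, Im z ^ k, x₂)` for `z = x₀ + s x₁ i`. -/
def windingVec (s : ℝ) (k : ℕ) (x : E3) : E3 :=
  !₂[(((x 0 : ℂ) + (s * x 1 : ℝ) * Complex.I) ^ k).re,
    (((x 0 : ℂ) + (s * x 1 : ℝ) * Complex.I) ^ k).im, x 2]

theorem contDiff_windingVec (s : ℝ) (k : ℕ) : ContDiff ℝ ∞ (windingVec s k) := by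
  have h0 : ∀ i : Fin 3, ContDiff ℝ ∞ fun x : E3 => x i := fun i =>
    (EuclideanSpace.proj i : E3 →L[ℝ] ℝ).contDiff
  have hz : ContDiff ℝ ∞ fun x : E3 => ((x 0 : ℂ) + (s * x 1 : ℝ) * Complex.I) ^ k :=
    ((Complex.ofRealCLM.contDiff.comp (h0 0)).add
      ((Complex.ofRealCLM.contDiff.comp (contDiff_const.mul (h0 1))).mul contDiff_const)).pow k
  rw [contDiff_euclidean]
  intro i
  fin_cases i
  · exact Complex.reCLM.contDiff.comp hz
  · exact Complex.imCLM.contDiff.comp hz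
  · exact h0 2

theorem windingVec_ne_zero {s : ℝ} (hs : s ≠ 0) (k : ℕ) {x : E3} (hx : x ≠ 0) :
    windingVec s k x ≠ 0 := by
  intro h
  have c0 : (((x 0 : ℂ) + (s * x 1 : ℝ) * Complex.I) ^ k).re = 0 := congrArg (fun y : E3 => y 0) h
  have c1 : (((x 0 : ℂ) + (s * x 1 : ℝ) * Complex.I) ^ k).im = 0 := congrArg (fun y : E3 => y 1) h
  have c2 : x 2 = 0 := congrArg (fun y : E3 => y 2) h
  have hz : (x 0 : ℂ) + (s * x 1 : ℝ) * Complex.I = 0 :=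
    eq_zero_of_pow_eq_zero (Complex.ext c0 c1)
  have r := congrArg Complex.re hz
  have i := congrArg Complex.im hz
  simp [hs] at r i
  apply hx
  ext j
  fin_cases j
  · exact r
  · exact i
  · exact c2

theorem windingVec_neg (s : ℝ) (k : ℕ) (x : E3) :
    windingVec s k (-x) = mirror ((-1) ^ k) (windingVec s k x) := by
  have hz : (((-x) 0 : ℝ) : ℂ) + (s * (-x) 1 : ℝ) * Complex.I =
      -((x 0 : ℂ) + (s * x 1 : ℝ) * Complex.I) := by
    simp; ring
  have he : ((-1 : ℂ)) ^ k = (((-1) ^ k : ℝ) : ℂ) := by push_cast; rfl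
  rw [mirror_apply]
  unfold windingVec
  rw [hz, neg_pow, he, Complex.re_ofReal_mul, Complex.im_ofReal_mul]
  rfl

theorem normalize_windingVec_mem_sphere {s : ℝ} (hs : s ≠ 0) (k : ℕ) (x : S2) :
    ‖windingVec s k x‖⁻¹ • windingVec s k x ∈ Metric.sphere (0 : E3) 1 := by
  have := windingVec_ne_zero hs k (ne_zero_of_mem_unit_sphere x)
  rw [mem_sphere_zero_iff_norm, norm_smul, norm_inv, norm_norm,
    inv_mul_cancel₀ (norm_ne_zero_iff.2 this)]

/-- The smooth map of the sphere to itself given by the direction of `windingVec`. -/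
def windingMap {s : ℝ} (hs : s ≠ 0) (k : ℕ) : C^∞⟮𝓡 2, S2; 𝓡 2, S2⟯ where
  val := Set.codRestrict (fun x : S2 => ‖windingVec s k x‖⁻¹ • windingVec s k x) _
    (normalize_windingVec_mem_sphere hs k)
  property := by
    refine ContMDiff.codRestrict_sphere (fun x => ?_) _
    have h : ContDiffAt ℝ ∞ (fun y : E3 => ‖windingVec s k y‖⁻¹ • windingVec s k y) x := by
      have hx := windingVec_ne_zero hs k (ne_zero_of_mem_unit_sphere x)
      have hc := (contDiff_windingVec s k).contDiffAt (x := (x : E3))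
      exact ((hc.norm ℝ hx).inv (norm_ne_zero_iff.2 hx)).smul hc
    exact h.contMDiffAt.comp x contMDiff_coe_sphere.contMDiffAt

theorem windingMap_coe {s : ℝ} (hs : s ≠ 0) (k : ℕ) (x : S2) :
    (windingMap hs k x : E3) = ‖windingVec s k x‖⁻¹ • windingVec s k x := rfl

theorem isOddForm_volForm_windingMap {s : ℝ} (hs : s ≠ 0) (k : ℕ) :
    IsOddForm (volForm (windingMap hs k)) := by
  have he : (((-1) ^ k : ℝ)) ^ 2 = 1 := by rw [← pow_mul, mul_comm, pow_mul]; simp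
  refine isOddForm_volForm_of_mirror ((windingMap hs k).contMDiff.mdifferentiable (by simp)) he
    fun x => ?_
  have hx : ((-x : S2) : E3) = -(x : E3) := rfl
  rw [windingMap_coe, windingMap_coe, hx, windingVec_neg, norm_mirror he, map_smul]

/-- De Moivre: for `s = ±1`, `z = sin θ · exp (i s φ)`. -/
theorem windingVec_spherical {s : ℝ} (hs : s = 1 ∨ s = -1) (k : ℕ) (p : ℝ × ℝ) :
    windingVec s k (spherical p) = !₂[Real.sin p.1 ^ k * Real.cos (s * k * p.2),
      Real.sin p.1 ^ k * Real.sin (s * k * p.2), Real.cos p.1] := by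
  have h0 : (spherical p : E3) 0 = Real.sin p.1 * Real.cos p.2 := rfl
  have h1 : (spherical p : E3) 1 = Real.sin p.1 * Real.sin p.2 := rfl
  have hz : (((spherical p : E3) 0 : ℝ) : ℂ) + (s * (spherical p : E3) 1 : ℝ) * Complex.I =
      (Real.sin p.1 : ℝ) *
        (Complex.cos ((s * p.2 : ℝ)) + Complex.sin ((s * p.2 : ℝ)) * Complex.I) := by
    rw [h0, h1]
    rcases hs with rfl | rfl <;> simp <;> ring
  have hk : (k : ℂ) * ((s * p.2 : ℝ) : ℂ) = ((s * k * p.2 : ℝ) : ℂ) := by push_cast; ring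
  unfold windingVec
  rw [hz, mul_pow, Complex.cos_add_sin_mul_I_pow, hk, ← Complex.ofReal_cos, ← Complex.ofReal_sin,
    ← Complex.ofReal_pow, Complex.re_ofReal_mul, Complex.im_ofReal_mul]
  simp only [Complex.add_re, Complex.add_im, Complex.ofReal_re, Complex.ofReal_im,
    Complex.re_ofReal_mul, Complex.im_ofReal_mul, Complex.I_re, Complex.I_im, mul_zero, mul_one,
    add_zero, zero_add]
  rfl

theorem degree_windingMap {s : ℝ} (hs : s = 1 ∨ s = -1) (hs0 : s ≠ 0) {k : ℕ} (hk : k ≠ 0) :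
    degree (windingMap hs0 k) = s * k := by
  have hpos : ∀ t, 0 < (Real.sin t ^ k) ^ 2 + Real.cos t ^ 2 := fun t => by
    by_cases hc : Real.cos t = 0
    · have : Real.sin t ≠ 0 := fun h => by
        have := Real.sin_sq_add_cos_sq t
        simp [h, hc] at this
      positivity
    · positivity
  -- The norm of `windingVec` at colatitude `t`; it does not depend on the longitude.
  set N : ℝ → ℝ := fun t => √((Real.sin t ^ k) ^ 2 + Real.cos t ^ 2) with hN
  have hN0 : ∀ t, N t ≠ 0 := fun t => (Real.sqrt_pos.2 (hpos t)).ne'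
  have hNc : ContDiff ℝ 1 N := by
    refine ContDiff.sqrt ?_ fun t => (hpos t).ne'
    fun_prop
  have hS : ContDiff ℝ 1 fun t => (N t)⁻¹ * Real.sin t ^ k :=
    (hNc.inv hN0).mul (by fun_prop)
  have hC : ContDiff ℝ 1 fun t => (N t)⁻¹ * Real.cos t := (hNc.inv hN0).mul (by fun_prop)
  refine degree_of_spherical _ (hS.differentiable one_ne_zero) hC (fun t => ?_) ?_ ?_ (s * k)
    fun p => ?_
  · have hsq : N t ^ 2 = (Real.sin t ^ k) ^ 2 + Real.cos t ^ 2 := Real.sq_sqrt (hpos t).le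
    rw [mul_pow, mul_pow, ← mul_add, ← hsq, ← mul_pow, inv_mul_cancel₀ (hN0 t), one_pow]
  -- At the poles `sin ^ k` vanishes because `k ≠ 0`, so the normalized height is `±1`.
  · simp [hN, hk]
  · simp [hN, hk]
  · have hn : ‖windingVec s k (spherical p)‖ = N p.1 := by
      rw [windingVec_spherical hs, EuclideanSpace.norm_eq, hN]
      simp only [Fin.sum_univ_three, Real.norm_eq_abs, sq_abs,
        Matrix.cons_val_zero, Matrix.cons_val_one, Matrix.cons_val]
      congr 1
      linear_combination (Real.sin p.1 ^ k) ^ 2 * Real.sin_sq_add_cos_sq (s * k * p.2)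
    rw [windingMap_coe, hn, windingVec_spherical hs]
    ext i
    fin_cases i <;> simp [mul_assoc]

end HiggsVacuum

end

theorem mainTheorem4 (m : ℤ) (hm : m ≠ 0) :
    ∃ f ∈ HiggsVacuum.vacuumSector m,
      HiggsVacuum.IsOddForm (HiggsVacuum.volForm (f : HiggsVacuum.S2 → HiggsVacuum.S2)) := by
  have hs : ((m.sign : ℤ) : ℝ) = 1 ∨ ((m.sign : ℤ) : ℝ) = -1 := by
    rcases lt_or_gt_of_ne hm with h | h
    · right; rw [Int.sign_eq_neg_one_of_neg h]; simp
    · left; rw [Int.sign_eq_one_of_pos h]; simp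
  have hs0 : ((m.sign : ℤ) : ℝ) ≠ 0 := by rcases hs with h | h <;> rw [h] <;> norm_num
  -- The degree is `s * k`, and `sign m * |m| = m`.
  refine ⟨HiggsVacuum.windingMap hs0 m.natAbs, ?_,
    HiggsVacuum.isOddForm_volForm_windingMap hs0 m.natAbs⟩
  change HiggsVacuum.degree _ = m
  rw [HiggsVacuum.degree_windingMap hs hs0 (Int.natAbs_ne_zero.2 hm)]
  rw [← Int.cast_natCast, ← Int.cast_mul, Int.sign_mul_natAbs]
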